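/- Let $d, K$ be natural numbers and let the $d$ coordinates of $[0,1]^d$ be partitioned into $K$ non-empty blocks, so that $[0,1]^d=\mathcal{X}_1\times\dots\times\mathcal{X}_K$ with $\mathcal{X}_k=[0,1]^{d_k}$, $d_k\ge 1$ and $\sum_{k} d_k=d$. For $x\in[0,1]^d$ and $I\subseteq\{1,\dots,K\}$ write $x_I=(x_k)_{k\in I}$. Let $\mathcal{P}([0,1]^d)$ be the set of Borel probability measures on $[0,1]^d$, and let $\mathcal{P}_{\rm CI}\subseteq\mathcal{P}([0,1]^d)$ be the set of all $\mu$ such that, for $X\sim\mu$ and all pairwise disjoint non-empty sets $I,J,J'\subseteq\{1,\dots,K\}$, the random vectors $X_J$ and $X_{J'}$ are conditionally independent given $X_I$. Let $$\mathcal{W}(\mu,\nu)=\inf_\pi\int\|x-y\|_\infty\,\pi(dx,dy)$$ be the first order Wasserstein distance, where $\pi$ ranges over the couplings of $\mu$ and $\nu$. **Theorem.** The set $\mathcal{P}_{\rm CI}$ is dense in $\mathcal{P}([0,1]^d)$ with respect to weak convergence of probability measures. Moreover, there is an absolute constant $C>0$ (independent of $d$, $n$, $K$ and the partition into blocks) such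 that, whenever $d\ge 3$ and $n\ge 8$, $$\inf_{E_n}\ \sup_{\mu\in\mathcal{P}_{\rm CI}}\int \mathcal{W}\big(E_n(x^1,\dots,x^n),\mu\big)\,\mu(dx^1)\cdots\mu(dx^n)\ \ge\ C\,n^{-1/d},$$ where the infimum ranges over all measurable maps $E_n:([0,1]^d)^n\to\mathcal{P}([0,1]^d)$. -/

import Mathlib

open MeasureTheory ProbabilityTheory
open scoped ENNReal unitInterval

/-- The cube `[0,1]^d`, with the product topology, the supremum distance and the Borel
σ-algebra. -/
abbrev Cube (d : ℕ) : Type := Fin d → I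

/-- The first order Wasserstein distance of two probability measures: the infimum over all
couplings `π` of `∫ dist(x, y) π(dx, dy)`. It takes values in `[0, ∞]`, so that no integrability
condition is needed. On `Cube d` the distance is the one of the supremum norm. -/
noncomputable def wasserstein {X : Type*} [PseudoEMetricSpace X] [MeasurableSpace X]
    (μ ν : ProbabilityMeasure X) : ℝ≥0∞ :=
  ⨅ (π : Measure (X × X)) (_ : π.map Prod.fst = μ) (_ : π.map Prod.snd = ν),
    ∫⁻ z, edist z.1 z.2 ∂π

/-- The minimax Wasserstein risk over a class `Q` of laws with `n` i.i.d. observations: the infimum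
over all estimators `E` (measurable maps from samples to probability measures) of the worst
expected error over `Q`. -/
noncomputable def wassersteinMinimaxRisk {X : Type*} [PseudoEMetricSpace X] [MeasurableSpace X]
    (Q : Set (ProbabilityMeasure X)) (n : ℕ) : ℝ≥0∞ :=
  ⨅ (E : (Fin n → X) → ProbabilityMeasure X) (_ : Measurable E),
    ⨆ μ ∈ Q, ∫⁻ x, wasserstein (E x) μ ∂(Measure.pi fun _ : Fin n => (μ : Measure X))

/-- The `d` coordinates of the cube are distributed over `K` variables: coordinate `i` belongs to
the variable `b i`. For a set `S` of variables, `blockProj b S` is the projection `x ↦ x_S` onto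
all coordinates that belong to a variable in `S`. -/
def blockProj {d K : ℕ} (b : Fin d → Fin K) (S : Set (Fin K)) (x : Cube d) : ↥(b ⁻¹' S) → I :=
  fun i => x i

theorem measurable_blockProj {d K : ℕ} (b : Fin d → Fin K) (S : Set (Fin K)) :
    Measurable (blockProj b S) :=
  measurable_pi_lambda _ fun i => measurable_pi_apply (i : Fin d)

/-- The laws on the cube under which, for all pairwise disjoint non-empty sets `S`, `T`, `T'` of
variables, `x_T` and `x_T'` are conditionally independent given (the σ-algebra generated by)
`x_S`. -/
def condIndepLaws {d K : ℕ} (b : Fin d → Fin K) : Set (ProbabilityMeasure (Cube d)) :=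
  {μ | ∀ S T T' : Set (Fin K), S.Nonempty → T.Nonempty → T'.Nonempty →
    Disjoint S T → Disjoint S T' → Disjoint T T' →
      CondIndepFun (MeasurableSpace.comap (blockProj b S) inferInstance)
        (measurable_blockProj b S).comap_le (blockProj b T) (blockProj b T') (μ : Measure (Cube d))}

/-! If a law has countably many atoms and any two atoms differ in every coordinate, a single
coordinate determines the whole point almost surely. Given any non-empty set of blocks everything
else is then deterministic, so all the conditional independences hold trivially
(`mem_condIndepLaws_of_map`). Rounding to a slightly perturbed grid produces such laws arbitrarily
close to any given law, hence density. They are also rich enough for a lower bound: choose one point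
from each of `2 * n` pairs of separated grid points. A sample of size `n` says nothing about the
choice in at least half of the pairs, so the estimator errs by the order of the mesh, about `n ^ (-1
/ d)` (`le_wassersteinMinimaxRisk`). -/

open Filter Topology

/-! ### Conditional independence for laws determined by one coordinate -/

section ConditionalIndependence

/-- Two functions are conditionally independent as soon as every event of the first one coincides
almost surely with an event of the conditioning σ-algebra. -/
theorem condIndepFun_of_forall_ae_eq {Ω β γ : Type*} {m' mΩ : MeasurableSpace Ω}
    [StandardBorelSpace Ω] [MeasurableSpace β] [MeasurableSpace γ] {hm' : m' ≤ mΩ}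
    {μ : Measure Ω} [IsFiniteMeasure μ] {f : Ω → β} {g : Ω → γ}
    (hf : Measurable f) (hg : Measurable g)
    (h : ∀ s, MeasurableSet s → ∃ B, MeasurableSet[m'] B ∧ f ⁻¹' s =ᵐ[μ] B) :
    CondIndepFun m' hm' f g μ := by
  rw [condIndepFun_iff_condExp_inter_preimage_eq_mul hf hg]
  intro s t hs ht
  obtain ⟨B, hB, hsB⟩ := h s hs
  have hint : Integrable ((g ⁻¹' t).indicator fun _ => (1 : ℝ)) μ :=
    (integrable_const _).indicator (hg ht)
  have hinter : μ⟦f ⁻¹' s ∩ g ⁻¹' t | m'⟧ =ᵐ[μ] B.indicator (μ⟦g ⁻¹' t | m'⟧) := by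
    refine EventuallyEq.trans (condExp_congr_ae ?_) (condExp_indicator hint hB)
    rw [Set.indicator_indicator]
    exact indicator_ae_eq_of_ae_eq_set (hsB.inter EventuallyEq.rfl)
  have hleft : μ⟦f ⁻¹' s | m'⟧ =ᵐ[μ] B.indicator fun _ => (1 : ℝ) := by
    refine (condExp_congr_ae (indicator_ae_eq_of_ae_eq_set hsB)).trans ?_
    rw [condExp_of_stronglyMeasurable hm' (stronglyMeasurable_const.indicator hB)
      ((integrable_const _).indicator (hm' _ hB))]
  filter_upwards [hinter, hleft] with x hx hy
  rw [hx, hy]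
  by_cases hxB : x ∈ B <;> simp [hxB]

/-- A law on the cube that is carried by countably many points, any two of which differ in all
coordinates, satisfies all the conditional independence relations. -/
theorem mem_condIndepLaws_of_map {d K : ℕ} (b : Fin d → Fin K) (hb : Function.Surjective b)
    {ι : Type*} [Countable ι] [MeasurableSpace ι] {p : ι → Cube d} (hp : Measurable p)
    (hinj : ∀ i, Function.Injective fun k => p k i) (ν : Measure ι)
    (μ : ProbabilityMeasure (Cube d)) (hμ : (μ : Measure (Cube d)) = ν.map p) :
    μ ∈ condIndepLaws b := by
  rintro S T T' ⟨s₀, hs₀⟩ - - - - -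
  obtain ⟨i, rfl⟩ := hb s₀
  refine condIndepFun_of_forall_ae_eq (measurable_blockProj b T) (measurable_blockProj b T') ?_
  intro s hs
  -- Values of the one coordinate `i` at the atoms in the event; by injectivity they single out
  -- exactly those atoms.
  set V : Set I := (fun k => p k i) '' {k | blockProj b T (p k) ∈ s} with hV
  have hVm : MeasurableSet V := ((Set.to_countable _).image _).measurableSet
  refine ⟨(fun x : Cube d => x i) ⁻¹' V,
    ⟨(fun y : ↥(b ⁻¹' S) → I => y ⟨i, hs₀⟩) ⁻¹' V, measurable_pi_apply _ hVm, rfl⟩, ?_⟩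
  have key : ∀ᵐ x ∂(μ : Measure (Cube d)), x ∈ Set.range p := by
    rw [hμ]
    refine (ae_map_iff (p := fun x => x ∈ Set.range p) hp.aemeasurable
      (Set.countable_range p).measurableSet).2 ?_
    exact Eventually.of_forall fun k => ⟨k, rfl⟩
  refine eventuallyEq_set.2 ?_
  filter_upwards [key]
  rintro _ ⟨k, rfl⟩
  exact ((hinj i).mem_set_image (s := {k | blockProj b T (p k) ∈ s})).symm

end ConditionalIndependence

/-! ### The perturbed grid -/

section Grid

/-- A point of the cell `k` of the regular grid of mesh `1 / (M + 1)`. It is moved away from the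
corner of the cell so that points of distinct cells differ in all coordinates. -/
noncomputable def gridPoint (d M : ℕ) (k : Fin d → Fin (M + 1)) : Cube d := fun i =>
  -- The factor 2 keeps the shift below half a cell, so differing cell indices still leave half a
  -- mesh between the coordinates.
  ⟨((k i : ℝ) + (Fintype.equivFin (Fin d → Fin (M + 1)) k : ℝ) /
      (2 * Fintype.card (Fin d → Fin (M + 1)))) / (M + 1), by
    have hk : (k i : ℝ) ≤ M := by exact_mod_cast Nat.lt_succ_iff.1 (k i).2
    have hc : (0 : ℝ) < Fintype.card (Fin d → Fin (M + 1)) := by exact_mod_cast Fintype.card_pos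
    have he : (Fintype.equivFin (Fin d → Fin (M + 1)) k : ℝ) ≤
        Fintype.card (Fin d → Fin (M + 1)) := by
      exact_mod_cast (Fintype.equivFin (Fin d → Fin (M + 1)) k).2.le
    refine ⟨by positivity, (div_le_one (by positivity)).2 (add_le_add hk ?_)⟩
    rw [div_le_one (by positivity)]
    linarith⟩

theorem exists_gridPoint_eq (d M : ℕ) : ∃ t : (Fin d → Fin (M + 1)) → ℝ, Function.Injective t ∧
    (∀ k, 0 ≤ t k ∧ t k < 1 / 2) ∧
    ∀ k i, ((gridPoint d M k i : I) : ℝ) = ((k i : ℝ) + t k) / (M + 1) := by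
  have hc : (0 : ℝ) < Fintype.card (Fin d → Fin (M + 1)) := by exact_mod_cast Fintype.card_pos
  refine ⟨fun k => (Fintype.equivFin (Fin d → Fin (M + 1)) k : ℝ) /
      (2 * Fintype.card (Fin d → Fin (M + 1))), fun k k' h => ?_, fun k => ⟨by positivity, ?_⟩,
      fun k i => rfl⟩
  · rw [div_left_inj' (by positivity)] at h
    exact (Fintype.equivFin _).injective (Fin.ext (by exact_mod_cast h))
  · have he : (Fintype.equivFin (Fin d → Fin (M + 1)) k : ℝ) <
        Fintype.card (Fin d → Fin (M + 1)) := by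
      exact_mod_cast (Fintype.equivFin (Fin d → Fin (M + 1)) k).2
    rw [div_lt_div_iff₀ (by positivity) (by norm_num)]
    linarith

theorem half_le_abs_sub_of_ne {a b : ℕ} {s t : ℝ} (hab : a ≠ b) (hs : 0 ≤ s ∧ s < 1 / 2)
    (ht : 0 ≤ t ∧ t < 1 / 2) : 1 / 2 ≤ |(a + s) - (b + t)| := by
  rw [le_abs]
  rcases lt_or_gt_of_ne hab with h | h
  · right
    have : (a : ℝ) + 1 ≤ b := by exact_mod_cast h
    linarith [hs.2, ht.1]
  · left
    have : (b : ℝ) + 1 ≤ a := by exact_mod_cast h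
    linarith [hs.1, ht.2]

theorem gridPoint_apply_injective (d M : ℕ) (i : Fin d) :
    Function.Injective fun k => gridPoint d M k i := by
  obtain ⟨t, ht, hb, he⟩ := exists_gridPoint_eq d M
  intro k k' h
  have h' : ((gridPoint d M k i : I) : ℝ) = gridPoint d M k' i := congrArg Subtype.val h
  rw [he, he, div_left_inj' (by positivity)] at h'
  by_cases hk : ((k i : ℕ)) = (k' i : ℕ)
  · rw [hk] at h'
    exact ht (add_left_cancel h')
  · have := half_le_abs_sub_of_ne hk (hb k) (hb k')
    rw [h', sub_self, abs_zero] at this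
    norm_num at this

theorem le_edist_gridPoint (d M : ℕ) {k k' : Fin d → Fin (M + 1)} (h : k ≠ k') :
    ENNReal.ofReal (1 / (2 * (M + 1))) ≤ edist (gridPoint d M k) (gridPoint d M k') := by
  obtain ⟨t, -, hb, he⟩ := exists_gridPoint_eq d M
  obtain ⟨i, hi⟩ := Function.ne_iff.1 h
  refine le_trans ?_ (edist_le_pi_edist _ _ i)
  rw [edist_dist]
  refine ENNReal.ofReal_le_ofReal ?_
  have hM : (0 : ℝ) < M + 1 := by positivity
  rw [Subtype.dist_eq, Real.dist_eq, he, he, ← sub_div, abs_div, abs_of_pos hM, ← div_div]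
  exact div_le_div_of_nonneg_right
    (half_le_abs_sub_of_ne (fun hk => hi (Fin.ext hk)) (hb k) (hb k')) hM.le

/-- The cell of the regular grid of mesh `1 / (M + 1)` that contains the point `x`. -/
noncomputable def gridCell (d M : ℕ) (x : Cube d) : Fin d → Fin (M + 1) := fun i =>
  -- The minimum only matters for a coordinate equal to 1, which joins the last cell.
  ⟨min ⌊((M : ℝ) + 1) * (x i : ℝ)⌋₊ M, Nat.lt_succ_iff.2 (min_le_right _ _)⟩

theorem measurable_gridCell (d M : ℕ) : Measurable (gridCell d M) := by
  refine measurable_pi_lambda _ fun i => ?_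
  have h : Measurable fun n : ℕ => (⟨min n M, Nat.lt_succ_iff.2 (min_le_right _ _)⟩ : Fin (M + 1)) :=
    measurable_from_top
  exact h.comp (Nat.measurable_floor.comp
    (((measurable_subtype_coe.comp (measurable_pi_apply i))).const_mul _))

theorem dist_gridPoint_gridCell_le (d M : ℕ) (x : Cube d) :
    dist (gridPoint d M (gridCell d M x)) x ≤ 1 / ((M : ℝ) + 1) := by
  obtain ⟨t, -, hb, he⟩ := exists_gridPoint_eq d M
  have hM : (0 : ℝ) < M + 1 := by positivity
  rw [dist_pi_le_iff (by positivity)]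
  intro i
  rw [Subtype.dist_eq, Real.dist_eq, he]
  obtain ⟨h0, h1⟩ := (x i).2
  obtain ⟨t0, t1⟩ := hb (gridCell d M x)
  set y : ℝ := ((M : ℝ) + 1) * (x i : ℝ) with hy
  have hy0 : 0 ≤ y := by positivity
  have hyM : y ≤ M + 1 := mul_le_of_le_one_right hM.le h1
  have hcell : ((gridCell d M x i : ℕ) : ℝ) ≤ y ∧ y ≤ (gridCell d M x i : ℕ) + 1 := by
    change ((min ⌊y⌋₊ M : ℕ) : ℝ) ≤ y ∧ y ≤ ((min ⌊y⌋₊ M : ℕ) : ℝ) + 1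
    rcases le_total ⌊y⌋₊ M with h | h
    · rw [min_eq_left h]
      exact ⟨Nat.floor_le hy0, (Nat.lt_floor_add_one y).le⟩
    · rw [min_eq_right h]
      exact ⟨(Nat.cast_le.2 h).trans (Nat.floor_le hy0), hyM⟩
  have hx : (x i : ℝ) = y / (M + 1) := by rw [hy]; field_simp
  rw [hx, ← sub_div, abs_div, abs_of_pos hM]
  refine div_le_div_of_nonneg_right ?_ hM.le
  rw [abs_le]
  constructor <;> linarith [hcell.1, hcell.2]

end Grid

/-! ### Density -/

theorem dense_condIndepLaws {d K : ℕ} (b : Fin d → Fin K) (hb : Function.Surjective b) :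
    Dense (condIndepLaws b) := by
  intro μ
  have hmeas (M : ℕ) : Measurable fun x => gridPoint d M (gridCell d M x) :=
    (measurable_of_countable (gridPoint d M)).comp (measurable_gridCell d M)
  refine mem_closure_of_tendsto (f := fun M : ℕ => μ.map (hmeas M).aemeasurable) (b := atTop)
    ?_ (Eventually.of_forall fun M => ?_)
  · rw [ProbabilityMeasure.tendsto_iff_forall_integral_tendsto]
    intro f
    simp only [ProbabilityMeasure.toMeasure_map]
    simp_rw [fun M => integral_map (μ := (μ : Measure (Cube d))) (hmeas M).aemeasurable
      f.continuous.aestronglyMeasurable]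
    refine tendsto_integral_of_dominated_convergence (fun _ => ‖f‖)
      (fun M => (f.continuous.measurable.comp (hmeas M)).aestronglyMeasurable)
      (integrable_const _) (fun M => Eventually.of_forall fun x => f.norm_coe_le_norm _)
      (Eventually.of_forall fun x => (f.continuous.tendsto x).comp ?_)
    rw [tendsto_iff_dist_tendsto_zero]
    exact squeeze_zero (fun _ => dist_nonneg) (fun M => dist_gridPoint_gridCell_le d M x)
      tendsto_one_div_add_atTop_nhds_zero_nat
  · refine mem_condIndepLaws_of_map b hb (measurable_of_countable (gridPoint d M))
      (gridPoint_apply_injective d M) ((μ : Measure (Cube d)).map (gridCell d M)) _ ?_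
    rw [Measure.map_map (measurable_of_countable _) (measurable_gridCell d M)]
    rfl

/-! ### Wasserstein distance and Lipschitz test functions -/

section Wasserstein

variable {X : Type*} [PseudoEMetricSpace X] [MeasurableSpace X]

/-- The easy half of Kantorovich duality. -/
theorem lintegral_le_lintegral_add_wasserstein {f : X → ℝ≥0∞} (hf : Measurable f)
    (hLip : ∀ x y, f x ≤ f y + edist x y) (μ ν : ProbabilityMeasure X) :
    ∫⁻ x, f x ∂(μ : Measure X) ≤ ∫⁻ x, f x ∂(ν : Measure X) + wasserstein μ ν := by
  simp only [wasserstein, ENNReal.add_iInf]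
  refine le_iInf fun π => le_iInf fun h₁ => le_iInf fun h₂ => ?_
  rw [← h₁, ← h₂, lintegral_map hf measurable_fst, lintegral_map hf measurable_snd,
    ← lintegral_add_left (f := fun z : X × X => f z.2) (hf.comp measurable_snd)]
  exact lintegral_mono fun z => hLip z.1 z.2

theorem wasserstein_comm (μ ν : ProbabilityMeasure X) : wasserstein μ ν = wasserstein ν μ := by
  suffices h : ∀ μ ν : ProbabilityMeasure X, wasserstein μ ν ≤ wasserstein ν μ from
    le_antisymm (h μ ν) (h ν μ)
  intro μ ν
  refine le_iInf fun π => le_iInf fun h₁ => le_iInf fun h₂ => ?_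
  refine iInf_le_of_le (π.map MeasurableEquiv.prodComm) (iInf_le_of_le ?_ (iInf_le_of_le ?_ ?_))
  · rw [Measure.map_map measurable_fst (MeasurableEquiv.measurable _)]
    exact h₂
  · rw [Measure.map_map measurable_snd (MeasurableEquiv.measurable _)]
    exact h₁
  · rw [MeasurableEquiv.prodComm.measurableEmbedding.lintegral_map]
    exact lintegral_mono fun z => (edist_comm _ _).le

theorem lintegral_le_lintegral_add_wasserstein_add {f : X → ℝ≥0∞} (hf : Measurable f)
    (hLip : ∀ x y, f x ≤ f y + edist x y) (ν μ μ' : ProbabilityMeasure X) :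
    ∫⁻ x, f x ∂(μ : Measure X) ≤
      ∫⁻ x, f x ∂(μ' : Measure X) + (wasserstein ν μ + wasserstein ν μ') := by
  calc ∫⁻ x, f x ∂(μ : Measure X)
      ≤ ∫⁻ x, f x ∂(ν : Measure X) + wasserstein ν μ := by
        rw [wasserstein_comm ν μ]
        exact lintegral_le_lintegral_add_wasserstein hf hLip μ ν
    _ ≤ ∫⁻ x, f x ∂(μ' : Measure X) + wasserstein ν μ' + wasserstein ν μ := by
        gcongr
        exact lintegral_le_lintegral_add_wasserstein hf hLip ν μ'
    _ = _ := by ring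

end Wasserstein

/-! ### Lower bound by random signs -/

section Minimax

/-- The uniform law on `m` indices. -/
noncomputable def uniformFin (m : ℕ) [NeZero m] : Measure (Fin m) :=
  (PMF.uniformOfFintype (Fin m)).toMeasure

instance (m : ℕ) [NeZero m] : IsProbabilityMeasure (uniformFin m) := by
  unfold uniformFin
  infer_instance

/-- The uniform law on one point out of each of `m` pairs, selected by the signs `ε`. -/
noncomputable def signLaw {X : Type*} [MeasurableSpace X] {m : ℕ} [NeZero m]
    (a : Fin m × Bool → X) (ε : Fin m → Bool) : ProbabilityMeasure X :=
  ⟨(uniformFin m).map fun j => a (j, ε j),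
    Measure.isProbabilityMeasure_map (measurable_of_countable _).aemeasurable⟩

theorem two_inv_le_uniformFin_compl_range {n m : ℕ} [NeZero m] (hm : 2 * n ≤ m)
    (J : Fin n → Fin m) : (2 : ℝ≥0∞)⁻¹ ≤ uniformFin m (Set.range J)ᶜ := by
  classical
  have hfin : (m : ℝ≥0∞) ≠ ⊤ := ENNReal.natCast_ne_top m
  have h0 : (m : ℝ≥0∞) ≠ 0 := Nat.cast_ne_zero.2 (NeZero.ne m)
  rw [uniformFin, PMF.toMeasure_uniformOfFintype_apply _ (Set.toFinite _).measurableSet,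
    Fintype.card_fin, ENNReal.le_div_iff_mul_le (Or.inl h0) (Or.inl hfin),
    ENNReal.inv_mul_le_iff (by norm_num) (by norm_num)]
  have h1 : Fintype.card (Set.range J) ≤ n := by
    simpa using Fintype.card_range_le J
  have h2 := Fintype.card_compl_set (Set.range J)
  rw [Fintype.card_fin] at h2
  exact_mod_cast (by omega : m ≤ 2 * Fintype.card ↥(Set.range J)ᶜ)

/-- Moves the risk to a finite index space whose law does not depend on `ε`. Since the map of
indices is a measurable embedding, `F` may be arbitrary. -/
theorem lintegral_pi_signLaw {X : Type*} [MeasurableSpace X] [MeasurableSingletonClass X]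
    {m : ℕ} [NeZero m] {n : ℕ}
    {a : Fin m × Bool → X} (ha : Function.Injective a) (ε : Fin m → Bool)
    (F : (Fin n → X) → ℝ≥0∞) :
    ∫⁻ x, F x ∂(Measure.pi fun _ : Fin n => (signLaw a ε : Measure X)) =
      ∫⁻ J, F (fun i => a (J i, ε (J i))) ∂(Measure.pi fun _ : Fin n => uniformFin m) := by
  have hprob : IsProbabilityMeasure ((uniformFin m).map fun j => a (j, ε j)) :=
    (signLaw a ε).2
  have hemb : MeasurableEmbedding fun (J : Fin n → Fin m) (i : Fin n) => a (J i, ε (J i)) := by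
    refine ⟨fun J J' h => ?_, measurable_of_countable _, fun s _ => (Set.toFinite _).measurableSet⟩
    funext i
    exact congrArg Prod.fst (ha (congrFun h i))
  rw [← hemb.lintegral_map]
  congr 1
  exact (Measure.pi_map_pi (f := fun _ j => a (j, ε j))
    fun _ => (measurable_of_countable _).aemeasurable).symm

variable {X : Type*} [PseudoEMetricSpace X] [MeasurableSpace X] [OpensMeasurableSpace X]

/-- The test function is the distance to the unseen atoms of `ε'`, cut off at `δ`. Both laws agree
on seen pairs; on unseen ones it is 0 for `ε'` and `δ` for `ε`, and these have mass at least 1/2. -/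
theorem half_le_wasserstein_add_wasserstein {n m : ℕ} [NeZero m] (hm : 2 * n ≤ m)
    {a : Fin m × Bool → X} {δ : ℝ≥0∞} (hδ : δ ≠ ⊤)
    (hsep : ∀ u v, u ≠ v → δ ≤ edist (a u) (a v)) (J : Fin n → Fin m) {ε ε' : Fin m → Bool}
    (hJ : ∀ j ∈ Set.range J, ε j = ε' j) (hJ' : ∀ j ∉ Set.range J, ε j ≠ ε' j)
    (ν : ProbabilityMeasure X) :
    δ / 2 ≤ wasserstein ν (signLaw a ε) + wasserstein ν (signLaw a ε') := by
  set A : Set X := (fun j => a (j, ε' j)) '' (Set.range J)ᶜ with hA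
  set f : X → ℝ≥0∞ := fun x => min (Metric.infEDist x A) δ with hf
  have hfm : Measurable f := measurable_infEDist.min measurable_const
  have hLip : ∀ x y, f x ≤ f y + edist x y := by
    intro x y
    have hmin : f y + edist x y = min (Metric.infEDist y A + edist x y) (δ + edist x y) :=
      (min_add_add_right _ _ _).symm
    rw [hmin]
    exact le_min ((min_le_left _ _).trans Metric.infEDist_le_infEDist_add_edist)
      ((min_le_right _ _).trans le_self_add)
  have hint (τ : Fin m → Bool) : ∫⁻ x, f x ∂(signLaw a τ : Measure X) =
      ∫⁻ j, f (a (j, τ j)) ∂uniformFin m :=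
    lintegral_map hfm (measurable_of_countable _)
  have key := lintegral_le_lintegral_add_wasserstein_add hfm hLip ν (signLaw a ε) (signLaw a ε')
  have hfinite : ∫⁻ x, f x ∂(signLaw a ε' : Measure X) ≠ ⊤ := by
    refine ne_top_of_le_ne_top hδ ((lintegral_mono fun x => min_le_right _ _).trans ?_)
    simp
  refine (ENNReal.add_le_add_iff_left hfinite).1 (le_trans ?_ key)
  rw [hint, hint]
  calc ∫⁻ j, f (a (j, ε' j)) ∂uniformFin m + δ / 2
      ≤ ∫⁻ j, f (a (j, ε' j)) ∂uniformFin m + δ * uniformFin m (Set.range J)ᶜ := by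
        rw [div_eq_mul_inv]
        gcongr
        exact two_inv_le_uniformFin_compl_range hm J
    _ = ∫⁻ j, (f (a (j, ε' j)) + (Set.range J)ᶜ.indicator (fun _ => δ) j) ∂uniformFin m := by
        rw [lintegral_add_left (measurable_of_countable _),
          lintegral_indicator_const (Set.toFinite _).measurableSet]
    _ ≤ ∫⁻ j, f (a (j, ε j)) ∂uniformFin m := by
        refine lintegral_mono fun j => ?_
        by_cases hj : j ∈ Set.range J
        · simp [hJ j hj, hj]
        · have h0 : f (a (j, ε' j)) = 0 := by
            have hmem : a (j, ε' j) ∈ A := ⟨j, hj, rfl⟩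
            simp only [hf, Metric.infEDist_zero_of_mem hmem, zero_min]
          have h1 : f (a (j, ε j)) = δ := by
            refine min_eq_right (Metric.le_infEDist.2 ?_)
            rintro _ ⟨j', -, rfl⟩
            refine hsep _ _ fun h => ?_
            obtain ⟨rfl, h'⟩ := Prod.ext_iff.1 h
            exact hJ' j hj h'
          simp [h0, h1, hj]

/-- If a class of laws contains all uniform laws on selections from `m ≥ 2 n` pairs of
`δ`-separated points, then the minimax risk with `n` observations is at least `δ / 4`. -/
theorem le_wassersteinMinimaxRisk [MeasurableSingletonClass X] {n m : ℕ} [NeZero m]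
    (hm : 2 * n ≤ m) {a : Fin m × Bool → X} (ha : Function.Injective a) {δ : ℝ≥0∞} (hδ : δ ≠ ⊤)
    (hsep : ∀ u v, u ≠ v → δ ≤ edist (a u) (a v)) {Q : Set (ProbabilityMeasure X)}
    (hQ : ∀ ε, signLaw a ε ∈ Q) : δ / 4 ≤ wassersteinMinimaxRisk Q n := by
  classical
  refine le_iInf fun E => le_iInf fun _ => ?_
  set P : Measure (Fin n → Fin m) := Measure.pi fun _ => uniformFin m with hP
  set G : (Fin m → Bool) → (Fin n → Fin m) → ℝ≥0∞ := fun ε J =>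
    wasserstein (E fun i => a (J i, ε (J i))) (signLaw a ε) with hG
  have hpoint (J : Fin n → Fin m) : ∑ _ε : Fin m → Bool, δ / 4 ≤ ∑ ε, G ε J := by
    -- Flipping the unseen signs leaves the sample, hence the estimate, unchanged; pairing `ε` with
    -- its flip bounds the average over signs.
    let flip : (Fin m → Bool) → (Fin m → Bool) := fun ε j =>
      if j ∈ Set.range J then ε j else !(ε j)
    have hflip : Function.Involutive flip := by
      intro ε
      funext j
      by_cases hj : j ∈ Set.range J <;> simp only [flip, hj, if_true, if_false, Bool.not_not]
    have hsum : ∑ ε, G (flip ε) J = ∑ ε, G ε J :=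
      Equiv.sum_comp (hflip.toPerm flip) fun ε => G ε J
    have hpair (ε : Fin m → Bool) : δ / 2 ≤ G ε J + G (flip ε) J := by
      have hdata : (fun i => a (J i, flip ε (J i))) = fun i => a (J i, ε (J i)) := by
        funext i
        simp only [flip, Set.mem_range_self, if_true]
      simp only [hG, hdata]
      refine half_le_wasserstein_add_wasserstein hm hδ hsep J (fun j hj => ?_) (fun j hj => ?_) _
      · simp only [flip, hj, if_true]
      · simp only [flip, hj, if_false]
        exact (Bool.not_ne_self _).symm
    have h2 : (2 : ℝ≥0∞) * ∑ _ε : Fin m → Bool, δ / 4 ≤ 2 * ∑ ε, G ε J := by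
      rw [two_mul (∑ ε, G ε J)]
      nth_rewrite 2 [← hsum]
      rw [← Finset.sum_add_distrib, Finset.mul_sum]
      refine Finset.sum_le_sum fun ε _ => le_trans (le_of_eq ?_) (hpair ε)
      rw [show (4 : ℝ≥0∞) = 2 * 2 by norm_num, ← mul_div_assoc,
        ENNReal.mul_div_mul_left _ _ (by norm_num) (by norm_num)]
    exact (ENNReal.mul_le_mul_iff_right (by norm_num) (by norm_num)).1 h2
  have htotal : ∑ _ε : Fin m → Bool, δ / 4 ≤ ∑ ε, ∫⁻ J, G ε J ∂P := by
    rw [← lintegral_finsetSum _ fun ε _ => measurable_of_countable _]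
    calc ∑ _ε : Fin m → Bool, δ / 4 = ∫⁻ _J, ∑ _ε : Fin m → Bool, δ / 4 ∂P := by simp [hP]
      _ ≤ _ := lintegral_mono hpoint
  obtain ⟨ε, -, hε⟩ := ENNReal.exists_le_of_sum_le Finset.univ_nonempty htotal
  refine hε.trans (le_trans (le_of_eq ?_) (le_iSup₂ (signLaw a ε) (hQ ε)))
  exact (lintegral_pi_signLaw ha ε fun x => wasserstein (E x) (signLaw a ε)).symm

end Minimax

/-! ### Choice of the mesh and conclusion -/

/-- The minimax risk is at least a constant times the mesh of a grid with `4 n` cells. -/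
theorem mesh_le_wassersteinMinimaxRisk_condIndepLaws {d K : ℕ} (b : Fin d → Fin K)
    (hb : Function.Surjective b) {n M : ℕ} (hn : 0 < n) (hM : 4 * n ≤ (M + 1) ^ d) :
    ENNReal.ofReal (1 / (2 * (M + 1))) / 4 ≤ wassersteinMinimaxRisk (condIndepLaws b) n := by
  have : NeZero (2 * n) := ⟨by omega⟩
  obtain ⟨c⟩ : Nonempty (Fin (2 * n) × Bool ↪ (Fin d → Fin (M + 1))) := by
    refine Function.Embedding.nonempty_of_card_le ?_
    simp only [Fintype.card_prod, Fintype.card_fin, Fintype.card_bool, Fintype.card_fun]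
    omega
  have hd : 0 < d := by
    rcases Nat.eq_zero_or_pos d with rfl | h
    · simp at hM
      omega
    · exact h
  have hinj : Function.Injective (gridPoint d M) := fun k k' h =>
    gridPoint_apply_injective d M ⟨0, hd⟩ (congrFun h _)
  refine le_wassersteinMinimaxRisk le_rfl (a := fun u => gridPoint d M (c u))
    (hinj.comp c.injective) ENNReal.ofReal_ne_top
    (fun u v huv => le_edist_gridPoint d M (c.injective.ne huv)) fun ε => ?_
  refine mem_condIndepLaws_of_map b hb (p := fun j => gridPoint d M (c (j, ε j)))
    (measurable_of_countable _) (fun i j j' h => ?_) (uniformFin (2 * n)) _ rfl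
  exact congrArg Prod.fst (c.injective (gridPoint_apply_injective d M i h))

theorem exists_grid_size {d n : ℕ} (hd : 3 ≤ d) (hn : 0 < n) : ∃ M : ℕ, 4 * n ≤ (M + 1) ^ d ∧
    (M : ℝ) + 1 ≤ 8 * (n : ℝ) ^ (1 / (d : ℝ)) := by
  have hd0 : (0 : ℝ) < d := by exact_mod_cast (by omega : 0 < d)
  have hn1 : (1 : ℝ) ≤ n := by exact_mod_cast hn
  set r : ℝ := (4 * n : ℝ) ^ (1 / (d : ℝ)) with hr
  have hr1 : 1 ≤ r := Real.one_le_rpow (by linarith) (by positivity)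
  refine ⟨⌊r⌋₊, ?_, ?_⟩
  · have h : (4 * n : ℝ) ≤ ((⌊r⌋₊ : ℝ) + 1) ^ d := by
      calc (4 * n : ℝ) = r ^ d := by
            rw [hr, one_div, Real.rpow_inv_natCast_pow (by positivity) (by omega)]
        _ ≤ _ := pow_le_pow_left₀ (by linarith) (Nat.lt_floor_add_one r).le d
    exact_mod_cast h
  · have h4 : (4 : ℝ) ^ (1 / (d : ℝ)) ≤ 4 := by
      calc (4 : ℝ) ^ (1 / (d : ℝ)) ≤ 4 ^ (1 : ℝ) :=
            Real.rpow_le_rpow_of_exponent_le (by norm_num)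
              ((div_le_one hd0).2 (by exact_mod_cast (by omega : 1 ≤ d)))
        _ = 4 := Real.rpow_one 4
    calc (⌊r⌋₊ : ℝ) + 1 ≤ r + r := add_le_add (Nat.floor_le (by linarith)) hr1
      _ = 2 * ((4 : ℝ) ^ (1 / (d : ℝ)) * (n : ℝ) ^ (1 / (d : ℝ))) := by
          rw [hr, Real.mul_rpow (by norm_num) (by positivity)]; ring
      _ ≤ 2 * (4 * (n : ℝ) ^ (1 / (d : ℝ))) := by gcongr
      _ = _ := by ring

theorem theorem4p2 :
    (∀ (d K : ℕ) (b : Fin d → Fin K), Function.Surjective b → Dense (condIndepLaws b)) ∧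
    ∃ C : ℝ, 0 < C ∧ ∀ (d K : ℕ) (b : Fin d → Fin K), Function.Surjective b → 3 ≤ d →
      ∀ n : ℕ, 8 ≤ n →
        ENNReal.ofReal (C * (n : ℝ) ^ (-(1 / (d : ℝ)))) ≤ wassersteinMinimaxRisk (condIndepLaws b) n := by
  -- 64 = 2 · 8 · 4: separation of half a mesh, grid size at most `8 * n ^ (1 / d)`, and the minimax
  -- loss `δ / 4`.
  refine ⟨fun d K b hb => dense_condIndepLaws b hb, 1 / 64, by norm_num, ?_⟩
  intro d K b hb hd n hn
  obtain ⟨M, hM, hM'⟩ := exists_grid_size hd (by omega : 0 < n)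
  refine le_trans ?_ (mesh_le_wassersteinMinimaxRisk_condIndepLaws b hb (by omega) hM)
  have hn0 : (0 : ℝ) < (n : ℝ) ^ (1 / (d : ℝ)) :=
    Real.rpow_pos_of_pos (by exact_mod_cast (by omega : 0 < n)) _
  rw [show (4 : ℝ≥0∞) = ENNReal.ofReal 4 by norm_num, ← ENNReal.ofReal_div_of_pos (by norm_num),
    Real.rpow_neg (Nat.cast_nonneg n)]
  refine ENNReal.ofReal_le_ofReal ?_
  calc 1 / 64 * ((n : ℝ) ^ (1 / (d : ℝ)))⁻¹
      = 1 / (2 * (8 * (n : ℝ) ^ (1 / (d : ℝ)))) / 4 := by field_simp; norm_num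
    _ ≤ 1 / (2 * ((M : ℝ) + 1)) / 4 := by gcongr
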